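/- Let $\alpha\ge 0$ be real and let $n,t,c$ be integers with $0\le t\le n-2$ and $c\ge 1$. For a simple graph $G$ let $M_\alpha(G)=A(G)+\alpha D(G)$, where $A(G)$ is the adjacency matrix and $D(G)$ the diagonal matrix of vertex degrees, and let $\Theta(G,\alpha)$ be the maximal eigenvalue of $M_\alpha(G)$. For connected $G$, the Perron vector $f_G$ is the unique positive unit vector with $M_\alpha(G)f_G=\Theta(G,\alpha)f_G$. A connected simple graph with $N$ vertices is called $c$-cyclic if it has $N+c-1$ edges. Let $\pi=(d_1\ge d_2\ge\dots\ge d_n)$ and let $\Gamma(\pi,t;c)$ be the class of graphs on $n$ vertices with degree sequence $\pi$ that are joins $K_t\vee H$ of the complete graph $K_t$ (the null graph if $t=0$) with a $c$-cyclic graph $H$ on $n-t$ vertices. For $c\ge 1$, the basic graph $\mathcal B(H)$ of a $c$-cyclic graph $H$ is the graph obtained from $H$ by recursively deleting pendant vertices (vertices of degree one) until no pendant vertices remain. Theorem. Let $G_\pi=K_t\vee H$, with $H$ a $c$-cyclic graph on $n-t$ vertices, be a graph of $\Gamma(\pi,t;c)$ whose value $\Theta(G_\pi,\alpha)$ is maximal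 among all graphs of $\Gamma(\pi,t;c)$. If $u\in V(\mathcal B(H))$ and $w\in V(H)\setminus V(\mathcal B(H))$, then $f_{G_\pi}(u)>f_{G_\pi}(w)$. -/

import Mathlib

noncomputable section

namespace ThetaMax

/-- The general matrix `M_α(G) = A(G) + α D(G)`. -/
def generalMatrix {V : Type*} [Fintype V] [DecidableEq V] (G : SimpleGraph V) (α : ℝ) :
    Matrix V V ℝ :=
  open Classical in G.adjMatrix ℝ + α • G.degMatrix ℝ

/-- The general spectral radius `Θ(G, α)`: the maximal eigenvalue of `M_α(G)`
(a real symmetric matrix, so that for a nonempty vertex set the supremum is attained). -/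
def generalSpectralRadius {V : Type*} [Fintype V] [DecidableEq V] (G : SimpleGraph V) (α : ℝ) :
    ℝ :=
  sSup {μ : ℝ | Module.End.HasEigenvalue (Matrix.toLin' (generalMatrix G α)) μ}

/-- `f` is the Perron vector of `M_α(G)`: the positive unit eigenvector (for the Euclidean norm)
belonging to the eigenvalue `Θ(G, α)`. Its entries are the `Θ_α`-weights of the vertices. -/
structure IsPerronVector {V : Type*} [Fintype V] [DecidableEq V] (G : SimpleGraph V) (α : ℝ)
    (f : V → ℝ) : Prop where
  pos : ∀ v, 0 < f v
  unit : ∑ v, f v ^ 2 = 1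
  eigen : (generalMatrix G α).mulVec f = generalSpectralRadius G α • f

/-- The join `G ∨ H` of two vertex-disjoint graphs. -/
def join {V W : Type*} (G : SimpleGraph V) (H : SimpleGraph W) : SimpleGraph (V ⊕ W) :=
  SimpleGraph.sum G H ⊔ completeBipartiteGraph V W

/-- A `c`-cyclic graph: connected, with `m = n + c - 1` edges on `n` vertices. -/
def IsCyclic {V : Type*} [Fintype V] (H : SimpleGraph V) (c : ℕ) : Prop :=
  H.Connected ∧ H.edgeSet.ncard + 1 = Fintype.card V + c

/-- `π` is the degree sequence of `G`: non-increasing, and listing the degrees of all vertices. -/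
def HasDegreeSequence {n : ℕ} (G : SimpleGraph (Fin n)) (π : Fin n → ℕ) : Prop :=
  Antitone π ∧ ∃ σ : Equiv.Perm (Fin n), ∀ i, (G.neighborSet (σ i)).ncard = π i

/-- The class `Γ(π, t; c)` of `t`-cone `c`-cyclic graphs with degree sequence `π`, where
`0 ≤ t ≤ n - 2`: graphs on the `n` labelled vertices `Fin n` isomorphic to `K_t ∨ H` for some
`c`-cyclic graph `H` on `n - t` vertices. -/
def coneClass {n : ℕ} (π : Fin n → ℕ) (t c : ℕ) : Set (SimpleGraph (Fin n)) :=
  {G | t + 2 ≤ n ∧ HasDegreeSequence G π ∧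
    ∃ H : SimpleGraph (Fin (n - t)), IsCyclic H c ∧
      Nonempty (G ≃g join (⊤ : SimpleGraph (Fin t)) H)}

/-- `G` is a `Θ_α`-maximal graph of the class `𝒢`. -/
def IsThetaMaximal {V : Type*} [Fintype V] [DecidableEq V] (α : ℝ) (𝒢 : Set (SimpleGraph V))
    (G : SimpleGraph V) : Prop :=
  G ∈ 𝒢 ∧ ∀ G' ∈ 𝒢, generalSpectralRadius G' α ≤ generalSpectralRadius G α

/-- `v` is a pendant vertex (a vertex of degree one) of the subgraph `B`. -/
def IsPendant {W : Type*} {H : SimpleGraph W} (B : H.Subgraph) (v : W) : Prop :=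
  v ∈ B.verts ∧ (B.neighborSet v).ncard = 1

/-- `B'` arises from `B` by deleting one pendant vertex. -/
def DeletesPendant {W : Type*} {H : SimpleGraph W} (B B' : H.Subgraph) : Prop :=
  ∃ v, IsPendant B v ∧ B' = B.deleteVerts {v}

/-- `B` is the basic graph `𝓑(H)`: it is obtained from `H` by recursively deleting pendant
vertices until no pendant vertices remain. -/
def IsBasicGraph {W : Type*} (H : SimpleGraph W) (B : H.Subgraph) : Prop :=
  Relation.ReflTransGen DeletesPendant (⊤ : H.Subgraph) B ∧ ∀ v, ¬ IsPendant B v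

end ThetaMax

end

/-! Suppose `u` lies in the basic graph, `w` outside it, and `f u ≤ f w`. Moving neighbours `S` of
`u` to `w`, and neighbours `T` of `w` to `u`, adds `p cᵀ + c pᵀ` to the adjacency matrix, with `p =
e_w - e_u` and `c = 1_S - 1_T`. If `S` is at least as large and as heavy as `T`, the quadratic form
at `f` does not drop. Maximality then makes `f` an eigenvector of the new matrix too, and row `u`
forces `S` and `T` to have equal weight (`moved_weight_eq_zero`, `sum_weight_eq_of_exchange`).

The contradiction comes by induction along the deletion process, with `w` pendant in the current
stage `K` (`weight_lt_of_isPendant`). If `w` has an already deleted neighbour `y`, then `y` is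
lighter than every basic vertex by induction, and trading it for a basic neighbour of `u` preserves
degrees. Otherwise `w` is a leaf of `H`; moving all but one neighbour of `u` to `w` interchanges
their two degrees. One neighbour `x₁` of `u` stays put, with a walk from it to `w` that keeps the
graph connected. -/

noncomputable section

namespace ThetaMax

open Matrix Finset

/-! ### Rayleigh quotient and rank-two perturbations -/

section Spectral
variable {V : Type*} [Fintype V] [DecidableEq V]

lemma generalMatrix_isHermitian (G : SimpleGraph V) (α : ℝ) : (generalMatrix G α).IsHermitian := by
  classical
  have h1 : (G.adjMatrix ℝ).IsHermitian := by
    rw [IsHermitian, conjTranspose_eq_transpose_of_trivial, SimpleGraph.transpose_adjMatrix]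
  have h2 : (G.degMatrix ℝ).IsHermitian := SimpleGraph.isHermitian_degMatrix ℝ G
  have h3 : (α • G.degMatrix ℝ).IsHermitian := by
    rw [IsHermitian, conjTranspose_smul, h2.eq, star_trivial]
  unfold generalMatrix
  convert h1.add h3

/-- The supremum of the eigenvalues of a real symmetric matrix bounds its quadratic form. -/
lemma posSemidef_sSup_eigenvalues_sub {M : Matrix V V ℝ} (hM : M.IsHermitian) :
    (sSup {μ : ℝ | Module.End.HasEigenvalue (toLin' M) μ} • (1 : Matrix V V ℝ) - M).PosSemidef := by
  set r := sSup {μ : ℝ | Module.End.HasEigenvalue (toLin' M) μ}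
  have hN : (r • (1 : Matrix V V ℝ) - M).IsHermitian := by
    rw [IsHermitian, conjTranspose_sub, hM.eq, conjTranspose_smul, star_trivial, conjTranspose_one]
  rw [hN.posSemidef_iff_eigenvalues_nonneg]
  intro i
  have hi := hN.mulVec_eigenvectorBasis i
  have hne : (hN.eigenvectorBasis i).ofLp ≠ 0 := by
    intro h
    exact hN.eigenvectorBasis.orthonormal.ne_zero i (by ext j; exact congrFun h j)
  -- An eigenvalue `ν` of `r • 1 - M` yields the eigenvalue `r - ν ≤ r` of `M`, whence `ν ≥ 0`.
  have hev : Module.End.HasEigenvalue (toLin' M) (r - hN.eigenvalues i) := by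
    refine Module.End.hasEigenvalue_of_hasEigenvector (x := (hN.eigenvectorBasis i).ofLp) ⟨?_, hne⟩
    rw [Module.End.mem_eigenspace_iff, toLin'_apply]
    rw [sub_mulVec, smul_mulVec, one_mulVec] at hi
    rw [sub_smul, ← hi]
    abel
  have hfin : {μ : ℝ | Module.End.HasEigenvalue (toLin' M) μ}.Finite :=
    Module.End.finite_hasEigenvalue _
  have := le_csSup hfin.bddAbove hev
  simp only [Pi.zero_apply]
  change r - _ ≤ r at this
  linarith

lemma sum_adjMatrix_row {V : Type*} [Fintype V] (G : SimpleGraph V) [DecidableRel G.Adj] (a : V) :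
    ∑ b, G.adjMatrix ℝ a b = G.degree a := by
  simp [SimpleGraph.adjMatrix_apply, ← SimpleGraph.card_neighborFinset_eq_degree,
    SimpleGraph.neighborFinset_eq_filter]

open Classical in
lemma generalMatrix_mulVec_apply (G : SimpleGraph V) (α : ℝ) (f : V → ℝ) (a : V) :
    (generalMatrix G α *ᵥ f) a =
      ∑ b, G.adjMatrix ℝ a b * f b + α * (∑ b, G.adjMatrix ℝ a b) * f a := by
  rw [sum_adjMatrix_row, generalMatrix, add_mulVec, smul_mulVec, Pi.add_apply, Pi.smul_apply]
  rw [SimpleGraph.degMatrix_mulVec_apply, smul_eq_mul, mul_assoc]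
  rfl

open Classical in
/-- Moving neighbours from `u` to a vertex `w` of at least the same weight changes the adjacency
matrix by `p cᵀ + c pᵀ`, where `p = e_w - e_u`. If this does not enlarge the spectral radius, then
the moved weight `c ⬝ᵥ f` cannot be positive. -/
lemma moved_weight_eq_zero {G G' : SimpleGraph V} {α : ℝ} (hα : 0 ≤ α) {f : V → ℝ}
    (hf : IsPerronVector G α f)
    (hle : generalSpectralRadius G' α ≤ generalSpectralRadius G α) {u w : V} (huw : u ≠ w)
    {c : V → ℝ} (hcu : c u = 0)
    (hA : ∀ a b, G'.adjMatrix ℝ a b = G.adjMatrix ℝ a b +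
      ((Pi.single w 1 - Pi.single u 1 : V → ℝ) a * c b +
        c a * (Pi.single w 1 - Pi.single u 1 : V → ℝ) b))
    (hc : 0 ≤ ∑ a, c a) (hcf : 0 ≤ ∑ a, c a * f a) (hfuw : f u ≤ f w) :
    ∑ a, c a * f a = 0 := by
  set p : V → ℝ := Pi.single w 1 - Pi.single u 1 with hp
  have hpf : ∀ g : V → ℝ, ∑ a, p a * g a = g w - g u := by
    intro g
    simp [hp, sub_mul, Finset.sum_sub_distrib, Pi.single_apply]
  have hp1 : ∑ a, p a = 0 := by simpa using hpf 1
  have hM : ∀ a, (generalMatrix G' α *ᵥ f) a = (generalMatrix G α *ᵥ f) a +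
      (p a * (∑ b, c b * f b) + c a * (f w - f u) + α * (∑ b, c b) * (p a * f a)) := by
    intro a
    rw [generalMatrix_mulVec_apply, generalMatrix_mulVec_apply]
    have e1 : ∑ b, G'.adjMatrix ℝ a b * f b = ∑ b, G.adjMatrix ℝ a b * f b +
        (p a * (∑ b, c b * f b) + c a * (f w - f u)) := by
      rw [← hpf f, Finset.mul_sum, Finset.mul_sum, ← Finset.sum_add_distrib,
        ← Finset.sum_add_distrib]
      exact Finset.sum_congr rfl fun b _ => by rw [hA]; ring
    have e2 : ∑ b, G'.adjMatrix ℝ a b = ∑ b, G.adjMatrix ℝ a b + p a * ∑ b, c b := by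
      have : c a * ∑ b, p b = 0 := by rw [hp1, mul_zero]
      rw [← add_zero (p a * _), ← this, Finset.mul_sum, Finset.mul_sum, ← Finset.sum_add_distrib,
        ← Finset.sum_add_distrib]
      exact Finset.sum_congr rfl fun b _ => by rw [hA]
    rw [e1, e2]; ring
  have hMu : ∀ a, (generalMatrix G α *ᵥ f) a = generalSpectralRadius G α * f a := fun a => by
    rw [hf.eigen]; rfl
  have hquad : f ⬝ᵥ (generalMatrix G' α *ᵥ f) = generalSpectralRadius G α +
      (2 * (f w - f u) * (∑ b, c b * f b) + α * (∑ b, c b) * (f w ^ 2 - f u ^ 2)) := by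
    have h1 : f ⬝ᵥ (generalMatrix G' α *ᵥ f) = ∑ a, (generalSpectralRadius G α * f a ^ 2 +
        ((∑ b, c b * f b) * (p a * f a) + (f w - f u) * (c a * f a) +
          α * (∑ b, c b) * (p a * f a ^ 2))) := by
      refine Finset.sum_congr rfl fun a _ => ?_
      rw [hM, hMu]; ring
    have h2 := hpf (fun a => f a ^ 2)
    rw [h1, Finset.sum_add_distrib, Finset.sum_add_distrib, Finset.sum_add_distrib,
      ← Finset.mul_sum, ← Finset.mul_sum, ← Finset.mul_sum, ← Finset.mul_sum, hpf f, h2, hf.unit]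
    ring
  have hpsd := posSemidef_sSup_eigenvalues_sub (generalMatrix_isHermitian G' α)
  change (generalSpectralRadius G' α • (1 : Matrix V V ℝ) - generalMatrix G' α).PosSemidef at hpsd
  have hff : f ⬝ᵥ f = 1 := by
    rw [← hf.unit]; exact Finset.sum_congr rfl fun a _ => by ring
  have hval : f ⬝ᵥ ((generalSpectralRadius G' α • (1 : Matrix V V ℝ) - generalMatrix G' α) *ᵥ f) =
      generalSpectralRadius G' α - f ⬝ᵥ (generalMatrix G' α *ᵥ f) := by
    rw [sub_mulVec, smul_mulVec, one_mulVec, dotProduct_sub, dotProduct_smul, hff, smul_eq_mul,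
      mul_one]
  have hge := hpsd.dotProduct_mulVec_nonneg f
  rw [star_trivial, hval, hquad] at hge
  have hsq : 0 ≤ f w ^ 2 - f u ^ 2 := by nlinarith [hf.pos u, hf.pos w]
  have t1 : 0 ≤ 2 * (f w - f u) * (∑ b, c b * f b) := mul_nonneg (by linarith) hcf
  have t2 : 0 ≤ α * (∑ b, c b) * (f w ^ 2 - f u ^ 2) := mul_nonneg (mul_nonneg hα hc) hsq
  have hrad : generalSpectralRadius G' α = generalSpectralRadius G α := by linarith
  have hz : star f ⬝ᵥ
      ((generalSpectralRadius G' α • (1 : Matrix V V ℝ) - generalMatrix G' α) *ᵥ f) = 0 := by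
    rw [star_trivial, hval, hquad]; linarith
  -- Since `c u = 0` and `p u = -1`, this row reads `c ⬝ᵥ f + α (∑ c) f u = 0`, a sum of two
  -- nonnegative terms.
  have hker := congrFun ((hpsd.dotProduct_mulVec_zero_iff f).mp hz) u
  rw [sub_mulVec, smul_mulVec, one_mulVec, Pi.sub_apply, hM, hMu, hrad, hcu] at hker
  have hpu : p u = -1 := by simp [hp, huw]
  rw [hpu] at hker
  simp only [Pi.smul_apply, smul_eq_mul, Pi.zero_apply] at hker
  have : 0 ≤ α * (∑ b, c b) * f u := mul_nonneg (mul_nonneg hα hc) (hf.pos u).le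
  linarith

end Spectral

/-! ### Exchanging neighbours of two vertices -/

section Exchange
variable {V : Type*}

/-- The graph obtained from `H` by moving the neighbours `S` of `u` to `w` and the neighbours `T`
of `w` to `u`. -/
def exchange (H : SimpleGraph V) (u w : V) (S T : Finset V) : SimpleGraph V where
  Adj a b := a ≠ b ∧
    ((H.Adj a b ∧ ¬ ((a = u ∧ b ∈ S) ∨ (b = u ∧ a ∈ S) ∨ (a = w ∧ b ∈ T) ∨ (b = w ∧ a ∈ T))) ∨
      (a = w ∧ b ∈ S) ∨ (b = w ∧ a ∈ S) ∨ (a = u ∧ b ∈ T) ∨ (b = u ∧ a ∈ T))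
  symm := ⟨fun a b h => by have := H.adj_comm a b; grind⟩
  loopless := ⟨fun _ h => h.1 rfl⟩

/-- `S` consists of neighbours of `u` different from `w` and not adjacent to `w`. -/
def IsMovable (H : SimpleGraph V) (u w : V) (S : Finset V) : Prop :=
  ∀ x ∈ S, H.Adj u x ∧ ¬ H.Adj w x ∧ x ≠ w

/-- The signed indicator function of the moved vertices. -/
def moved [DecidableEq V] (S T : Finset V) (x : V) : ℝ := (if x ∈ S then 1 else 0) - (if x ∈ T then 1 else 0)

variable {H : SimpleGraph V} {u w : V} {S T : Finset V}

lemma exchange_adj {a b : V} : (exchange H u w S T).Adj a b ↔ a ≠ b ∧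
    ((H.Adj a b ∧ ¬ ((a = u ∧ b ∈ S) ∨ (b = u ∧ a ∈ S) ∨ (a = w ∧ b ∈ T) ∨ (b = w ∧ a ∈ T))) ∨
      (a = w ∧ b ∈ S) ∨ (b = w ∧ a ∈ S) ∨ (a = u ∧ b ∈ T) ∨ (b = u ∧ a ∈ T)) :=
  Iff.rfl

-- Movability makes `S` and `T` disjoint and ensures that no added edge is already present, so the
-- change is exactly of rank-two form.
open Classical in
lemma adjMatrix_exchange [Fintype V] [DecidableEq V] (huw : u ≠ w) (hS : IsMovable H u w S)
    (hT : IsMovable H w u T) (a b : V) :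
    (exchange H u w S T).adjMatrix ℝ a b = H.adjMatrix ℝ a b +
      ((Pi.single w 1 - Pi.single u 1 : V → ℝ) a * moved S T b +
        moved S T a * (Pi.single w 1 - Pi.single u 1 : V → ℝ) b) := by
  have hSu : u ∉ S := fun h => H.irrefl (hS u h).1
  have hSw : w ∉ S := fun h => (hS w h).2.2 rfl
  have hTw : w ∉ T := fun h => H.irrefl (hT w h).1
  have hTu : u ∉ T := fun h => (hT u h).2.2 rfl
  have hdis : ∀ x ∈ S, x ∉ T := fun x h h' => (hS x h).2.1 (hT x h').1
  have hsymm := H.adj_comm a b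
  simp only [SimpleGraph.adjMatrix_apply, Pi.sub_apply, Pi.single_apply, moved, exchange_adj]
  have hSa := hS a
  have hSb := hS b
  have hTa := hT a
  have hTb := hT b
  have hdb := hdis b
  have hda := hdis a
  have hirr : a = b → ¬ H.Adj a b := fun h => h ▸ H.irrefl
  by_cases ha : a = u
  · subst ha
    by_cases hbS : b ∈ S
    · grind
    · by_cases hbT : b ∈ T <;> grind
  · by_cases ha' : a = w
    · subst ha'
      by_cases hbS : b ∈ S
      · grind
      · by_cases hbT : b ∈ T <;> grind
    · by_cases hb : b = u
      · subst hb
        have := H.adj_comm a b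
        by_cases haS : a ∈ S
        · grind
        · by_cases haT : a ∈ T <;> grind
      · by_cases hb' : b = w
        · subst hb'
          by_cases haS : a ∈ S
          · grind
          · by_cases haT : a ∈ T <;> grind
        · grind

lemma sum_moved_mul [Fintype V] [DecidableEq V] (f : V → ℝ) :
    ∑ x, moved S T x * f x = ∑ x ∈ S, f x - ∑ x ∈ T, f x := by
  simp [moved, sub_mul, Finset.sum_sub_distrib]

lemma sum_moved [Fintype V] [DecidableEq V] : ∑ x, moved S T x = (S.card : ℝ) - T.card := by
  simpa using sum_moved_mul (S := S) (T := T) (fun _ => 1)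

open Classical in
lemma ncard_neighborSet_eq_sum [Fintype V] (G : SimpleGraph V) (a : V) :
    ((G.neighborSet a).ncard : ℝ) = ∑ b, G.adjMatrix ℝ a b := by
  rw [sum_adjMatrix_row, Set.ncard_eq_toFinset_card', ← SimpleGraph.card_neighborFinset_eq_degree]
  rfl

open Classical in
lemma two_mul_ncard_edgeSet_eq_sum [Fintype V] (G : SimpleGraph V) :
    2 * (G.edgeSet.ncard : ℝ) = ∑ a, ∑ b, G.adjMatrix ℝ a b := by
  simp only [sum_adjMatrix_row]
  rw [Set.ncard_eq_toFinset_card']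
  exact_mod_cast G.sum_degrees_eq_twice_card_edges.symm

open Classical in
lemma sum_adjMatrix_rankTwo [Fintype V] [DecidableEq V] {G G' : SimpleGraph V} {c : V → ℝ}
    (hA : ∀ a b, G'.adjMatrix ℝ a b = G.adjMatrix ℝ a b +
      ((Pi.single w 1 - Pi.single u 1 : V → ℝ) a * c b +
        c a * (Pi.single w 1 - Pi.single u 1 : V → ℝ) b)) (a : V) :
    ∑ b, G'.adjMatrix ℝ a b = ∑ b, G.adjMatrix ℝ a b +
      (Pi.single w 1 - Pi.single u 1 : V → ℝ) a * ∑ b, c b := by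
  simp_rw [hA, Finset.sum_add_distrib, ← Finset.mul_sum]
  simp [Finset.sum_sub_distrib]

/-- The entries of `p cᵀ + c pᵀ` sum to zero because those of `p` do, so the number of edges is
unchanged. -/
lemma isCyclic_exchange [Fintype V] {k : ℕ} (hH : IsCyclic H k) (huw : u ≠ w)
    (hS : IsMovable H u w S) (hT : IsMovable H w u T) (hconn : (exchange H u w S T).Connected) :
    IsCyclic (exchange H u w S T) k := by
  classical
  refine ⟨hconn, ?_⟩
  rw [← hH.2]
  have h1 := two_mul_ncard_edgeSet_eq_sum (exchange H u w S T)
  have h2 := two_mul_ncard_edgeSet_eq_sum H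
  simp_rw [sum_adjMatrix_rankTwo (adjMatrix_exchange huw hS hT), Finset.sum_add_distrib,
    ← Finset.sum_mul] at h1
  rw [← h2] at h1
  simp [Finset.sum_sub_distrib] at h1
  rw [h1]

end Exchange

/-! ### Exchanges inside the cone -/

section Cone
variable {n t c : ℕ}

/-- The graph on `Fin n` which `φ` identifies with `K_t ∨ H'`. -/
def coneOf {G : SimpleGraph (Fin n)} {H : SimpleGraph (Fin (n - t))}
    (φ : G ≃g join (⊤ : SimpleGraph (Fin t)) H) (H' : SimpleGraph (Fin (n - t))) :
    SimpleGraph (Fin n) :=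
  (join (⊤ : SimpleGraph (Fin t)) H').comap φ

variable {G : SimpleGraph (Fin n)} {H : SimpleGraph (Fin (n - t))}
  {φ : G ≃g join (⊤ : SimpleGraph (Fin t)) H}

lemma coneOf_adj {H' : SimpleGraph (Fin (n - t))} {a b : Fin n} :
    (coneOf φ H').Adj a b ↔ (join (⊤ : SimpleGraph (Fin t)) H').Adj (φ a) (φ b) := Iff.rfl

-- The cone vertices are joined to everything before and after, so the perturbation extends by zero.
open Classical in
lemma adjMatrix_coneOf {H' : SimpleGraph (Fin (n - t))} {u w : Fin (n - t)} {d : Fin (n - t) → ℝ}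
    (hA : ∀ a b, H'.adjMatrix ℝ a b = H.adjMatrix ℝ a b +
      ((Pi.single w 1 - Pi.single u 1 : Fin (n - t) → ℝ) a * d b +
        d a * (Pi.single w 1 - Pi.single u 1 : Fin (n - t) → ℝ) b)) (a b : Fin n) :
    (coneOf φ H').adjMatrix ℝ a b = G.adjMatrix ℝ a b +
      ((Pi.single (φ.symm (.inr w)) 1 - Pi.single (φ.symm (.inr u)) 1 : Fin n → ℝ) a *
          Sum.elim (0 : Fin t → ℝ) d (φ b) +
        Sum.elim (0 : Fin t → ℝ) d (φ a) *
          (Pi.single (φ.symm (.inr w)) 1 - Pi.single (φ.symm (.inr u)) 1 : Fin n → ℝ) b) := by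
  obtain ⟨a, rfl⟩ := φ.symm.surjective a
  obtain ⟨b, rfl⟩ := φ.symm.surjective b
  have hG : ∀ x y, G.Adj (φ.symm x) (φ.symm y) ↔ (join (⊤ : SimpleGraph (Fin t)) H).Adj x y :=
    fun x y => φ.symm.map_adj_iff
  simp only [SimpleGraph.adjMatrix_apply, coneOf_adj, hG,
    RelIso.apply_symm_apply, Pi.sub_apply, Pi.single_apply, EmbeddingLike.apply_eq_iff_eq] at hA ⊢
  rcases a with a | a <;> rcases b with b | b
  · simp [join]
  · simp [join]
  · simp [join]
  · simpa [join, Pi.single_apply] using hA a b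

lemma sum_cone_eq (φ : G ≃g join (⊤ : SimpleGraph (Fin t)) H) (g : Fin n → ℝ) :
    ∑ a, g a = ∑ y, g (φ.symm (.inl y)) + ∑ x, g (φ.symm (.inr x)) := by
  rw [← Fintype.sum_sum_type fun x => g (φ.symm x)]
  exact (Equiv.sum_comp φ.symm.toEquiv g).symm

lemma sum_sumElim_mul {d : Fin (n - t) → ℝ} (f : Fin n → ℝ) :
    ∑ a, Sum.elim (0 : Fin t → ℝ) d (φ a) * f a = ∑ x, d x * f (φ.symm (.inr x)) := by
  rw [sum_cone_eq φ]
  simp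

lemma ncard_neighborSet_cone (x : Fin (n - t)) :
    ((G.neighborSet (φ.symm (.inr x))).ncard : ℝ) = t + (H.neighborSet x).ncard := by
  classical
  rw [ncard_neighborSet_eq_sum, ncard_neighborSet_eq_sum, sum_cone_eq φ]
  have hG : ∀ x y, G.Adj (φ.symm x) (φ.symm y) ↔ (join (⊤ : SimpleGraph (Fin t)) H).Adj x y :=
    fun x y => φ.symm.map_adj_iff
  simp only [SimpleGraph.adjMatrix_apply, hG]
  simp [join]

/-- In a maximal cone, an admissible exchange between `u` and a vertex `w` of at least the same
weight cannot increase the weight moved to `w`. -/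
lemma sum_weight_eq_of_exchange {α : ℝ} (hα : 0 ≤ α) {π : Fin n → ℕ}
    (hG : IsThetaMaximal α (coneClass π t c) G) (hH : IsCyclic H c)
    (φ : G ≃g join (⊤ : SimpleGraph (Fin t)) H) {f : Fin n → ℝ} (hf : IsPerronVector G α f)
    {u w : Fin (n - t)} (huw : u ≠ w) {S T : Finset (Fin (n - t))}
    (hS : IsMovable H u w S) (hT : IsMovable H w u T) (hconn : (exchange H u w S T).Connected)
    (hcard : T.card ≤ S.card)
    (hdeg : S.card = T.card ∨
      S.card + (H.neighborSet w).ncard = T.card + (H.neighborSet u).ncard)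
    (hfuw : f (φ.symm (.inr u)) ≤ f (φ.symm (.inr w)))
    (hfST : ∑ x ∈ T, f (φ.symm (.inr x)) ≤ ∑ x ∈ S, f (φ.symm (.inr x))) :
    ∑ x ∈ S, f (φ.symm (.inr x)) = ∑ x ∈ T, f (φ.symm (.inr x)) := by
  classical
  set G' := coneOf φ (exchange H u w S T) with hG'
  have hA := adjMatrix_coneOf (φ := φ) (adjMatrix_exchange huw hS hT)
  have huw' : φ.symm (.inr u) ≠ φ.symm (.inr w) := by simpa using huw
  have hsum : ∑ a, Sum.elim (0 : Fin t → ℝ) (moved S T) (φ a) = (S.card : ℝ) - T.card := by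
    rw [← sum_moved]
    simpa using sum_sumElim_mul (φ := φ) (d := moved S T) (fun _ => 1)
  have hsumf : ∑ a, Sum.elim (0 : Fin t → ℝ) (moved S T) (φ a) * f a =
      ∑ x ∈ S, f (φ.symm (.inr x)) - ∑ x ∈ T, f (φ.symm (.inr x)) := by
    rw [sum_sumElim_mul, sum_moved_mul]
  have hrow : ∀ a, ((G'.neighborSet a).ncard : ℝ) = (G.neighborSet a).ncard +
      (Pi.single (φ.symm (.inr w)) 1 - Pi.single (φ.symm (.inr u)) 1 : Fin n → ℝ) a *
        ((S.card : ℝ) - T.card) := by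
    intro a
    rw [ncard_neighborSet_eq_sum, ncard_neighborSet_eq_sum, ← hsum]
    exact sum_adjMatrix_rankTwo hA a
  obtain ⟨⟨htn, ⟨hanti, σ, hσ⟩, -⟩, hmax⟩ := hG
  have hmem : G' ∈ coneClass π t c := by
    refine ⟨htn, ⟨hanti, ?_⟩, exchange H u w S T, isCyclic_exchange hH huw hS hT hconn, ?_⟩
    · rcases hdeg with h | h
      · refine ⟨σ, fun i => ?_⟩
        rw [← hσ i]
        have := hrow (σ i)
        rw [h, sub_self, mul_zero, add_zero] at this
        exact_mod_cast this
      -- Here `u` and `w` have interchanged degrees, so the old enumeration is corrected by a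
      -- transposition.
      · refine ⟨σ.trans (Equiv.swap (φ.symm (.inr u)) (φ.symm (.inr w))), fun i => ?_⟩
        rw [← hσ i, Equiv.trans_apply]
        have hu := ncard_neighborSet_cone (φ := φ) u
        have hw := ncard_neighborSet_cone (φ := φ) w
        have h' : (S.card : ℝ) + (H.neighborSet w).ncard =
          T.card + (H.neighborSet u).ncard := by exact_mod_cast h
        have key : ((G'.neighborSet (Equiv.swap (φ.symm (.inr u)) (φ.symm (.inr w)) (σ i))).ncard :
            ℝ) = (G.neighborSet (σ i)).ncard := by
          rw [hrow]
          by_cases h1 : σ i = φ.symm (.inr u)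
          · rw [h1, Equiv.swap_apply_left, hu, hw]
            simp [huw.symm]
            linarith
          · by_cases h2 : σ i = φ.symm (.inr w)
            · rw [h2, Equiv.swap_apply_right, hu, hw]
              simp [huw]
              linarith
            · rw [Equiv.swap_apply_of_ne_of_ne h1 h2]
              simp [h1, h2]
        exact_mod_cast key
    · exact ⟨⟨φ.toEquiv, Iff.rfl⟩⟩
  have := moved_weight_eq_zero hα hf (hmax G' hmem) huw' (c := fun a => Sum.elim (0 : Fin t → ℝ) (moved S T) (φ a))
    ?_ hA ?_ ?_ hfuw
  · rw [hsumf] at this; linarith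
  · have hSu : u ∉ S := fun h => H.irrefl (hS u h).1
    have hTu : u ∉ T := fun h => (hT u h).2.2 rfl
    simp [moved, hSu, hTu]
  · rw [hsum]
    have : (T.card : ℝ) ≤ S.card := by exact_mod_cast hcard
    linarith
  · rw [hsumf]; linarith

end Cone

/-! ### Connectedness after an exchange -/

section Connectivity
variable {V : Type*} {H K : SimpleGraph V} {u w : V} {S T : Finset V}

/-- A vertex `w` with at most one neighbour can be reached from `u` through a neighbour `x` of `u`,
without returning to `u`, such that `x` is the only neighbour of `u` equal or adjacent to `w`. -/
lemma exists_adj_walk_avoiding (huw : u ≠ w) (hr : K.Reachable u w)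
    (hw : (K.neighborSet w).Subsingleton) :
    ∃ x, K.Adj u x ∧ (∃ q : K.Walk x w, u ∉ q.support) ∧
      ∀ z, K.Adj u z → z = w ∨ K.Adj w z → z = x := by
  by_cases h1 : K.Adj u w
  · refine ⟨w, h1, ⟨.nil, by simpa using huw⟩, ?_⟩
    rintro z hz (rfl | h)
    · rfl
    · exact absurd hz (hw h h1.symm ▸ K.irrefl)
  by_cases h2 : ∃ p, K.Adj u p ∧ K.Adj w p
  · obtain ⟨p, hup, hwp⟩ := h2
    refine ⟨p, hup, ⟨.cons hwp.symm .nil, ?_⟩, ?_⟩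
    · simpa [huw] using hup.ne
    · rintro z hz (rfl | h)
      · exact absurd hz h1
      · exact hw h hwp
  -- Without an edge or a common neighbour, any path will do: the uniqueness clause is vacuous.
  · obtain ⟨p, hp⟩ := hr.exists_isPath
    cases p with
    | nil => exact absurd rfl huw
    | cons h q =>
      rw [SimpleGraph.Walk.cons_isPath_iff] at hp
      refine ⟨_, h, ⟨q, hp.2⟩, ?_⟩
      rintro z hz (rfl | h')
      · exact absurd hz h1
      · exact absurd ⟨z, hz, h'⟩ h2

/-- Only edges from `u` to `S` and from `w` to `T` are cut; the route through `x` and `q` uses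
neither. -/
lemma exchange_reachable (hKH : K ≤ H) (huw : u ≠ w) (hT : IsMovable H w u T) {x : V}
    (hux : K.Adj u x) (hxS : x ∉ S) (q : K.Walk x w) (hq : u ∉ q.support)
    (hTK : ∀ y ∈ T, ¬ K.Adj w y) : (exchange H u w S T).Reachable u w := by
  have hTu : u ∉ T := fun h => (hT u h).2.2 rfl
  have h1 : (exchange H u w S T).Adj u x := by
    refine ⟨hux.ne, .inl ⟨hKH hux, ?_⟩⟩
    have := hux.ne
    grind
  refine h1.reachable.trans ⟨q.transfer _ fun e he => ?_⟩
  induction e with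
  | _ a b =>
  have ha : a ≠ u := fun h => hq (h ▸ q.fst_mem_support_of_mem_edges he)
  have hb : b ≠ u := fun h => hq (h ▸ q.snd_mem_support_of_mem_edges he)
  have hab : K.Adj a b := q.adj_of_mem_edges he
  have hba := hab.symm
  rw [SimpleGraph.mem_edgeSet]
  refine ⟨hab.ne, .inl ⟨hKH hab, ?_⟩⟩
  grind

/-- The ends of each cut edge stay linked through `u` and `w`. -/
lemma exchange_connected (hH : H.Connected) (hS : IsMovable H u w S)
    (hT : IsMovable H w u T) (hr : (exchange H u w S T).Reachable u w) :
    (exchange H u w S T).Connected := by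
  have hSw : ∀ x ∈ S, (exchange H u w S T).Reachable u x := fun x hx =>
    hr.trans (SimpleGraph.Adj.reachable ⟨(hS x hx).2.2.symm, by simp [hx]⟩)
  have hTu : ∀ x ∈ T, (exchange H u w S T).Reachable u x := fun x hx =>
    SimpleGraph.Adj.reachable ⟨(hT x hx).2.2.symm, by simp [hx]⟩
  have hadj : ∀ a b, H.Adj a b → (exchange H u w S T).Reachable a b := by
    intro a b hab
    by_cases h : (a = u ∧ b ∈ S) ∨ (b = u ∧ a ∈ S) ∨ (a = w ∧ b ∈ T) ∨ (b = w ∧ a ∈ T)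
    · rcases h with ⟨rfl, h⟩ | ⟨rfl, h⟩ | ⟨rfl, h⟩ | ⟨rfl, h⟩
      · exact hSw _ h
      · exact (hSw _ h).symm
      · exact hr.symm.trans (hTu _ h)
      · exact (hTu _ h).symm.trans hr
    · exact SimpleGraph.Adj.reachable ⟨hab.ne, .inl ⟨hab, h⟩⟩
  have := hH.nonempty
  refine ⟨fun a b => ?_⟩
  obtain ⟨p⟩ := hH.preconnected a b
  induction p with
  | nil => rfl
  | cons h _ ih => exact (hadj _ _ h).trans ih

end Connectivity

/-! ### Stages of the pendant-deletion process -/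

section Deletion
variable {W : Type*} {H : SimpleGraph W}

/-- The properties of the subgraphs arising from a connected graph containing a cycle by
recursively deleting pendant vertices. -/
structure IsStage (K : H.Subgraph) : Prop where
  adj : ∀ a ∈ K.verts, ∀ b ∈ K.verts, H.Adj a b → K.Adj a b
  unique : ∀ y ∉ K.verts, ∀ a ∈ K.verts, ∀ b ∈ K.verts, H.Adj y a → H.Adj y b → a = b
  reach : ∀ a ∈ K.verts, ∀ b ∈ K.verts, K.spanningCoe.Reachable a b
  card : K.verts.ncard ≤ K.edgeSet.ncard

/-- This is where `1 ≤ c` enters: it gives at least as many edges as vertices. -/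
lemma isStage_top [Fintype W] {c : ℕ} (hc : 1 ≤ c) (hH : IsCyclic H c) :
    IsStage (⊤ : H.Subgraph) where
  adj := fun _ _ _ _ h => h
  unique := fun y hy => absurd (Set.mem_univ y) hy
  reach := fun a _ b _ => by
    rw [SimpleGraph.Subgraph.spanningCoe_top]; exact hH.1.preconnected a b
  card := by
    have := hH.2
    simp only [SimpleGraph.Subgraph.verts_top, Set.ncard_univ, Nat.card_eq_fintype_card,
      SimpleGraph.Subgraph.edgeSet_top]
    omega

lemma IsPendant.exists_adj_unique {K : H.Subgraph} {v : W} (hv : IsPendant K v) :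
    ∃ p, K.Adj v p ∧ ∀ x, K.Adj v x → x = p := by
  obtain ⟨p, hp⟩ := Set.ncard_eq_one.mp hv.2
  have h : ∀ x, K.Adj v x ↔ x = p := fun x => by
    rw [← SimpleGraph.Subgraph.mem_neighborSet, hp, Set.mem_singleton_iff]
  exact ⟨p, (h p).2 rfl, fun x => (h x).1⟩

/-- A path between other vertices avoids `v`, which has one neighbour; one vertex and at most one
edge are lost. -/
lemma IsStage.deletePendant [Finite W] {K : H.Subgraph} (hK : IsStage K) {v : W}
    (hv : IsPendant K v) : IsStage (K.deleteVerts {v}) := by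
  obtain ⟨p, hvp, hp⟩ := hv.exists_adj_unique
  refine ⟨?_, ?_, ?_, ?_⟩
  · rintro a ⟨ha, ha'⟩ b ⟨hb, hb'⟩ hab
    exact SimpleGraph.Subgraph.deleteVerts_adj.mpr ⟨ha, ha', hb, hb', hK.adj a ha b hb hab⟩
  · rintro y hy a ⟨ha, -⟩ b ⟨hb, -⟩ hya hyb
    by_cases hyK : y ∈ K.verts
    · obtain rfl : y = v := by
        by_contra h
        exact hy ⟨hyK, h⟩
      rw [hp a (hK.adj y hyK a ha hya), hp b (hK.adj y hyK b hb hyb)]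
    · exact hK.unique y hyK a ha b hb hya hyb
  · rintro a ⟨ha, ha'⟩ b ⟨hb, hb'⟩
    obtain ⟨q, hq⟩ := (hK.reach a ha b hb).exists_isPath
    have hvq : v ∉ q.support := by
      refine hq.isTrail.not_mem_support_of_subsingleton_neighborSet (Ne.symm ha') (Ne.symm hb') ?_
      intro x hx y hy
      rw [hp x hx, hp y hy]
    refine ⟨q.transfer _ fun e he => ?_⟩
    induction e with
    | _ x y =>
    have hx : x ≠ v := fun h => hvq (h ▸ q.fst_mem_support_of_mem_edges he)
    have hy : y ≠ v := fun h => hvq (h ▸ q.snd_mem_support_of_mem_edges he)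
    have hxy : K.Adj x y := q.adj_of_mem_edges he
    exact SimpleGraph.Subgraph.deleteVerts_adj.mpr ⟨hxy.fst_mem, hx, hxy.snd_mem, hy, hxy⟩
  · have h1 : (K.deleteVerts {v}).verts.ncard = K.verts.ncard - 1 :=
      Set.ncard_sdiff_singleton_of_mem hv.1
    have h2 : K.edgeSet ⊆ insert s(v, p) (K.deleteVerts {v}).edgeSet := by
      intro e he
      induction e with
      | _ x y =>
      have hxy : K.Adj x y := he
      by_cases hx : x = v
      · subst hx
        rw [hp y hxy]
        exact Set.mem_insert _ _
      by_cases hy : y = v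
      · subst hy
        rw [hp x hxy.symm, Sym2.eq_swap]
        exact Set.mem_insert _ _
      · exact Set.mem_insert_of_mem _
          (SimpleGraph.Subgraph.deleteVerts_adj.mpr ⟨hxy.fst_mem, hx, hxy.snd_mem, hy, hxy⟩)
    have h3 := (Set.ncard_le_ncard h2 (Set.toFinite _)).trans (Set.ncard_insert_le _ _)
    have := hK.card
    omega

lemma isStage_of_reflTransGen [Finite W] {K B : H.Subgraph} (hK : IsStage K)
    (h : Relation.ReflTransGen DeletesPendant K B) : IsStage B := by
  induction h with
  | refl => exact hK
  | tail _ h ih =>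
    obtain ⟨v, hv, rfl⟩ := h
    exact ih.deletePendant hv

lemma verts_subset_of_reflTransGen {K B : H.Subgraph}
    (h : Relation.ReflTransGen DeletesPendant K B) : B.verts ⊆ K.verts := by
  induction h with
  | refl => exact subset_rfl
  | tail _ h ih =>
    obtain ⟨v, hv, rfl⟩ := h
    exact Set.sdiff_subset.trans ih

/-- Every vertex of the basic graph has a neighbour in it besides any given vertex. -/
lemma IsStage.exists_adj_ne [Finite W] {B : H.Subgraph} (hB : IsStage B)
    (hnp : ∀ v, ¬ IsPendant B v) {u : W} (hu : u ∈ B.verts) (x : W) : ∃ z, B.Adj u z ∧ z ≠ x := by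
  by_contra! h
  have hux : ¬ B.Adj u x := by
    intro hux
    refine hnp u ⟨hu, Set.ncard_eq_one.mpr ⟨x, ?_⟩⟩
    ext z
    exact ⟨h z, fun hz => by rw [Set.mem_singleton_iff.mp hz]; exact hux⟩
  -- Now `u` is isolated, so `B` is a single vertex without edges, against `hB.card`.
  have hno : ∀ z, ¬ B.Adj u z := fun z hz => hux (h z hz ▸ hz)
  have hverts : ∀ a ∈ B.verts, a = u := by
    intro a ha
    obtain ⟨p⟩ := hB.reach u hu a ha
    cases p with
    | nil => rfl
    | cons h _ => exact absurd h (hno _)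
  have hedge : B.edgeSet = ∅ := by
    refine Set.eq_empty_of_forall_notMem fun e he => ?_
    induction e with
    | _ a b =>
    have hab : B.Adj a b := he
    exact hno b (hverts a hab.fst_mem ▸ hab)
  have := hB.card
  rw [hedge, Set.ncard_empty] at this
  have := (Set.ncard_pos (Set.toFinite _)).mpr ⟨u, hu⟩
  omega

end Deletion

/-! ### Comparison of weights -/

section Main
variable {n t c : ℕ} {α : ℝ} {π : Fin n → ℕ} {G : SimpleGraph (Fin n)}
  {H : SimpleGraph (Fin (n - t))}

/-- If all vertices outside a stage `K` of the deletion process are lighter than those of the basic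
graph, then so is every pendant vertex of `K`. -/
lemma weight_lt_of_isPendant (hα : 0 ≤ α) (hG : IsThetaMaximal α (coneClass π t c) G)
    (hH : IsCyclic H c) (φ : G ≃g join (⊤ : SimpleGraph (Fin t)) H) {f : Fin n → ℝ}
    (hf : IsPerronVector G α f) {K B : H.Subgraph} (hK : IsStage K) (hB : IsStage B)
    (hnp : ∀ v, ¬ IsPendant B v) (hBK : B.verts ⊆ K.verts)
    (ih : ∀ y ∉ K.verts, ∀ x ∈ B.verts, f (φ.symm (.inr y)) < f (φ.symm (.inr x)))
    {u w : Fin (n - t)} (hu : u ∈ B.verts) (hw : w ∉ B.verts) (hwK : IsPendant K w) :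
    f (φ.symm (.inr w)) < f (φ.symm (.inr u)) := by
  classical
  by_contra! hle
  have huw : u ≠ w := fun h => hw (h ▸ hu)
  obtain ⟨p, hwp, hp⟩ := hwK.exists_adj_unique
  obtain ⟨x₁, hux₁, ⟨q, hq⟩, hx₁⟩ := exists_adj_walk_avoiding huw (hK.reach u (hBK hu) w hwK.1)
    (fun x hx y hy => by rw [hp x hx, hp y hy])
  have hux₁' : K.Adj u x₁ := hux₁
  by_cases hleaf : ∃ y ∉ K.verts, H.Adj w y
  · obtain ⟨y, hyK, hwy⟩ := hleaf
    obtain ⟨x, hux, hx⟩ := hB.exists_adj_ne hnp hu x₁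
    have hxK : K.Adj u x := hK.adj u (hBK hu) x (hBK hux.snd_mem) hux.adj_sub
    have hS : IsMovable H u w {x} := by
      intro z hz
      rw [Finset.mem_singleton] at hz
      subst hz
      refine ⟨hux.adj_sub, fun h => hx ?_, fun h => hw (h ▸ hux.snd_mem)⟩
      exact hx₁ z hxK (.inr (hK.adj w hwK.1 z (hBK hux.snd_mem) h))
    have hT : IsMovable H w u {y} := by
      intro z hz
      rw [Finset.mem_singleton] at hz
      subst hz
      refine ⟨hwy, fun h => huw ?_, fun h => hyK (h ▸ hBK hu)⟩
      exact hK.unique z hyK u (hBK hu) w hwK.1 h.symm hwy.symm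
    have hr : (exchange H u w {x} {y}).Reachable u w := by
      refine exchange_reachable K.spanningCoe_le huw hT hux₁ (by simpa using hx.symm) q hq ?_
      intro z hz h
      rw [Finset.mem_singleton] at hz
      subst hz
      exact hyK (SimpleGraph.Subgraph.Adj.snd_mem h)
    have hlt := ih y hyK x hux.snd_mem
    have := sum_weight_eq_of_exchange hα hG hH φ hf huw hS hT (exchange_connected hH.1 hS hT hr)
      (by simp) (.inl (by simp)) hle (by simpa using hlt.le)
    simp only [Finset.sum_singleton] at this
    exact hlt.ne' this
  · push Not at hleaf
    have hnw : H.neighborSet w = {p} := by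
      ext z
      refine ⟨fun hz => hp z ?_, fun hz => ?_⟩
      · by_contra h
        exact hleaf z (fun hzK => h (hK.adj w hwK.1 z hzK hz)) hz
      · rw [Set.mem_singleton_iff.mp hz]; exact hwp.adj_sub
    have hwH : ∀ z, H.Adj w z → K.Adj w z := fun z hz => by
      have : z ∈ H.neighborSet w := hz
      rw [hnw] at this
      rw [Set.mem_singleton_iff.mp this]; exact hwp
    -- `|S|` is `deg u - 1` and `deg w = 1`, so the move interchanges the two degrees.
    set S : Finset (Fin (n - t)) := (H.neighborFinset u).erase x₁ with hSdef
    have hScard : S.card + 1 = (H.neighborSet u).ncard := by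
      rw [hSdef, Finset.card_erase_add_one (by simpa using hux₁'.adj_sub),
        Set.ncard_eq_toFinset_card']
      rfl
    have hS : IsMovable H u w S := by
      intro z hz
      rw [hSdef, Finset.mem_erase, SimpleGraph.mem_neighborFinset] at hz
      have key : z ∈ K.verts → ¬ (z = w ∨ K.Adj w z) := fun hzK h =>
        hz.1 (hx₁ z (hK.adj u (hBK hu) z hzK hz.2) h)
      refine ⟨hz.2, fun h => ?_, fun h => ?_⟩
      · exact key (hwH z h).snd_mem (.inr (hwH z h))
      · exact key (h ▸ hwK.1) (.inl h)
    have hT : IsMovable H w u ∅ := by intro z hz; simp at hz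
    have hr : (exchange H u w S ∅).Reachable u w :=
      exchange_reachable K.spanningCoe_le huw hT hux₁ (by simp [hSdef]) q hq (by simp)
    have hpos : 0 < ∑ x ∈ S, f (φ.symm (.inr x)) := by
      obtain ⟨x, hux, hx⟩ := hB.exists_adj_ne hnp hu x₁
      refine Finset.sum_pos (fun z _ => hf.pos _) ⟨x, ?_⟩
      rw [hSdef, Finset.mem_erase, SimpleGraph.mem_neighborFinset]
      exact ⟨hx, hux.adj_sub⟩
    have := sum_weight_eq_of_exchange hα hG hH φ hf huw hS hT (exchange_connected hH.1 hS hT hr)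
      (by simp) (.inr (by rw [hnw, Set.ncard_singleton, hScard]; simp)) hle (by simpa using hpos.le)
    rw [Finset.sum_empty] at this
    exact hpos.ne' this

end Main

end ThetaMax

end

/-- Let `G` be a `Θ_α`-maximal graph of `Γ(π, t; c)` with `c ≥ 1`, written as `G = K_t ∨ H` (through
the isomorphism `φ`), let `f` be its Perron vector and `B` the basic graph of `H`. Every vertex of
`B` has strictly larger weight than every vertex of `H` outside `B`. -/
theorem theorem3p7 {n t c : ℕ} (hc : 1 ≤ c) (α : ℝ) (hα : 0 ≤ α) (π : Fin n → ℕ)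
    (G : SimpleGraph (Fin n))
    (hG : ThetaMax.IsThetaMaximal α (ThetaMax.coneClass π t c) G)
    (H : SimpleGraph (Fin (n - t))) (hH : ThetaMax.IsCyclic H c)
    (φ : G ≃g ThetaMax.join (⊤ : SimpleGraph (Fin t)) H)
    (f : Fin n → ℝ) (hf : ThetaMax.IsPerronVector G α f)
    (B : H.Subgraph) (hB : ThetaMax.IsBasicGraph H B)
    (u w : Fin (n - t)) (hu : u ∈ B.verts) (hw : w ∉ B.verts) :
    f (φ.symm (Sum.inr w)) < f (φ.symm (Sum.inr u)) := by
  have hstage := ThetaMax.isStage_top hc hH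
  have hBs := ThetaMax.isStage_of_reflTransGen hstage hB.1
  -- The deletion sequence is cut at `K`: the part before it carries the induction, the part after
  -- it gives `B ⊆ K`.
  have key : ∀ K : H.Subgraph, Relation.ReflTransGen ThetaMax.DeletesPendant ⊤ K →
      Relation.ReflTransGen ThetaMax.DeletesPendant K B →
      ∀ w ∉ K.verts, ∀ u ∈ B.verts, f (φ.symm (.inr w)) < f (φ.symm (.inr u)) := by
    intro K hK
    induction hK with
    | refl => exact fun _ w hw => absurd (Set.mem_univ w) hw
    | @tail K K' hK hdel ih =>
      intro hKB w hw u hu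
      have ih' := ih (.head hdel hKB)
      have hBK' := ThetaMax.verts_subset_of_reflTransGen hKB
      have hBK := ThetaMax.verts_subset_of_reflTransGen (.head hdel hKB)
      obtain ⟨v, hv, rfl⟩ := hdel
      by_cases hwK : w ∈ K.verts
      · obtain rfl : w = v := by
          by_contra h
          exact hw ⟨hwK, h⟩
        exact ThetaMax.weight_lt_of_isPendant hα hG hH φ hf
          (ThetaMax.isStage_of_reflTransGen hstage hK) hBs hB.2 hBK ih' hu (fun h => hw (hBK' h)) hv
      · exact ih' w hwK u hu
  exact key B hB.1 .refl w hw u hu
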